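/- \textbf{Setting.} Let $m\ge 1$, $n=2^m$, $[m]=\{1,\dots,m\}$. For $A\subseteq[m]$ let $v_m(A)\in\mathbb F_2^{n}$ be the vector, indexed by $z\in\{0,1\}^m$, with components $v_m(A,z)=\prod_{i\in A}z_i$ (evaluation of a monomial). Order the subsets of $[m]$ by the Reed--Muller order: $A<B$ if $|A|>|B|$, or if $|A|=|B|$ and, writing $A=\{a_1>a_2>\dots\}$ and $B=\{b_1>b_2>\dots\}$, there is an $i$ with $a_j=b_j$ for all $j<i$ and $a_i<b_i$. A BMS channel is a map $W:\{0,1\}\to\mathcal Y$ with finite output alphabet $\mathcal Y$, given by transition probabilities $W(y|x)$, such that some involution $\pi$ of $\mathcal Y$ satisfies $W(y|1)=W(\pi(y)|0)$ for all $y$. Let $(U_A)_{A\subseteq[m]}$ be i.i.d. uniform bits, put $X_z=\sum_{A\subseteq[m]}U_A\,v_m(A,z)$ (mod $2$), and let $Y=(Y_z)_{z\in\{0,1\}^m}$ be the outputs when the $n$ bits $X_z$ are sent through $n$ independent copies of $W$. With $U_{<A}=(U_B)_{B<A}$, set $$H_A^{(m)}=H(U_A\mid Y,U_{<A}),\qquad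 Z_A^{(m)}=\sum_{t}\sqrt{P(t\mid U_A=0)\,P(t\mid U_A=1)},$$ where $H(\cdot\mid\cdot)$ is conditional entropy in bits and $t$ ranges over all possible values of $(Y,U_{<A})$. \textbf{Theorem (Polarization of RM codes).} Let $0<\epsilon<1/10$, let $0<\gamma<1/2$, and let $(\delta_n)$ be a real sequence that decays at most polynomially, i.e. there are $c>0$ and $d\in\mathbb N$ with $\delta_n\ge c\,n^{-d}$ for all large $n$ (as is the case whenever $\delta_n=\mathrm{poly}(1/n)$). Then there is a constant $M=M(\epsilon,(\delta_n),\gamma)$, independent of the channel, such that for every BMS channel $W$ and every $m>M$, with $n=2^m$, $$\frac{\bigl|\{A\subseteq[m]:H_A^{(m)}>1-\epsilon\}\cup\{A\subseteq[m]:Z_A^{(m)}<\delta_n\}\bigr|}{2^m}\ \ge\ 1-m^{\gamma-1/2}.$$ -/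

import Mathlib

/-! ### Binary memoryless symmetric channels -/

/-- A binary-input discrete symmetric channel `W : {0,1} → Y` with finite output alphabet `Y`.
`trans x y` is the transition probability `W(y|x)`. Symmetry: there is an involution `π` of the
output alphabet with `W(y|1) = W(π y|0)` for all `y`. (Memorylessness is expressed by
`rmJoint` below, where independent copies of the channel are used.) -/
structure BMSChannel (Y : Type*) [Fintype Y] where
  trans : ZMod 2 → Y → ℝ
  nonneg : ∀ x y, 0 ≤ trans x y
  sum_eq_one : ∀ x, ∑ y, trans x y = 1
  symm : ∃ π : Equiv.Perm Y, Function.Involutive π ∧ ∀ y, trans 1 y = trans 0 (π y)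

/-! ### Conditional entropy and Bhattacharyya parameter

`p : Ω → ℝ` is the probability mass function of a finite probability space, and random variables
are functions on `Ω`. -/

open Classical in
/-- The probability that the random variable `X` takes the value `s`. -/
noncomputable def probEq {Ω S : Type*} [Fintype Ω] (p : Ω → ℝ) (X : Ω → S) (s : S) : ℝ :=
  ∑ ω with X ω = s, p ω

/-- The conditional entropy in bits
`H(X|Y) = ∑ₜ P(Y = t) ∑ₛ -P(X = s|Y = t) log₂ P(X = s|Y = t)`. -/
noncomputable def condEntropy {Ω S T : Type*} [Fintype Ω] [Fintype S] [Fintype T]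
    (p : Ω → ℝ) (X : Ω → S) (Y : Ω → T) : ℝ :=
  ∑ t, probEq p Y t *
    ∑ s, Real.negMulLog (probEq p (fun ω => (X ω, Y ω)) (s, t) / probEq p Y t) / Real.log 2

/-- The Bhattacharyya parameter `Z(X|Y) = ∑ₜ √(P(Y = t|X = 0) P(Y = t|X = 1))` of a binary random
variable `X` given `Y`. -/
noncomputable def bhattacharyya {Ω T : Type*} [Fintype Ω] [Fintype T]
    (p : Ω → ℝ) (X : Ω → ZMod 2) (Y : Ω → T) : ℝ :=
  ∑ t, √((probEq p (fun ω => (X ω, Y ω)) (0, t) / probEq p X 0) *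
    (probEq p (fun ω => (X ω, Y ω)) (1, t) / probEq p X 1))

/-! ### Rows of the Reed-Muller matrix and their ordering

The set `[m]` is `Fin m` with its usual order; `{0,1}` is `ZMod 2`. -/

/-- The row `v_m(A)`: the evaluation of the monomial `∏_{i ∈ A} Z_i` at `z`. -/
def rmRow {m : ℕ} (A : Finset (Fin m)) (z : Fin m → ZMod 2) : ZMod 2 :=
  ∏ i ∈ A, z i

/-- The Reed-Muller order on the subsets of `[m]`: `A < B` if `|A| > |B|`, or `|A| = |B|` and the
list of the elements of `A` in decreasing order is lexicographically smaller than that of `B`. -/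
def rmLT {m : ℕ} (A B : Finset (Fin m)) : Prop :=
  B.card < A.card ∨ (A.card = B.card ∧ A.sort (· ≥ ·) < B.sort (· ≥ ·))

instance {m : ℕ} (A B : Finset (Fin m)) : Decidable (rmLT A B) :=
  inferInstanceAs (Decidable (_ ∨ _))

/-! ### The probability space: uniform input bits sent through independent copies of `W` -/

/-- Sample points: the input bits `(u_A)_{A ⊆ [m]}` and the channel outputs `(y_z)_{z ∈ {0,1}^m}`. -/
abbrev RMSample (m : ℕ) (Y : Type*) : Type _ :=
  (Finset (Fin m) → ZMod 2) × ((Fin m → ZMod 2) → Y)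

/-- The codeword bit `X_z = ∑_{A ⊆ [m]} u_A v_m(A, z)` over the two-element field. -/
def rmEncode {m : ℕ} (u : Finset (Fin m) → ZMod 2) (z : Fin m → ZMod 2) : ZMod 2 :=
  ∑ A, u A * rmRow A z

/-- The joint law of `(U, Y)`: the `2^m` bits `U_A` are i.i.d. uniform, and given `U = u` the outputs
`Y_z` are independent with `Y_z ∼ W(· | X_z)`. -/
noncomputable def rmJoint {Y : Type*} [Fintype Y] (W : BMSChannel Y) (m : ℕ)
    (ω : RMSample m Y) : ℝ :=
  (1 / 2 : ℝ) ^ (2 ^ m) * ∏ z, W.trans (rmEncode ω.1 z) (ω.2 z)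

/-- The random variable `U_A`. -/
def rmInput {m : ℕ} {Y : Type*} (A : Finset (Fin m)) (ω : RMSample m Y) : ZMod 2 :=
  ω.1 A

/-- The random variable `(Y, U_{<A})`: all channel outputs together with all inputs `U_B`, `B < A`. -/
def rmObserved {m : ℕ} {Y : Type*} (A : Finset (Fin m)) (ω : RMSample m Y) :
    ((Fin m → ZMod 2) → Y) × ({B : Finset (Fin m) // rmLT B A} → ZMod 2) :=
  (ω.2, fun B => ω.1 B.1)

/-- `H_A = H(U_A | Y, U_{<A})`. -/
noncomputable def rmH {Y : Type*} [Fintype Y] (W : BMSChannel Y) {m : ℕ}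
    (A : Finset (Fin m)) : ℝ :=
  condEntropy (rmJoint W m) (rmInput A) (rmObserved A)

/-- `Z_A = Z(U_A | Y, U_{<A})`. -/
noncomputable def rmZ {Y : Type*} [Fintype Y] (W : BMSChannel Y) {m : ℕ}
    (A : Finset (Fin m)) : ℝ :=
  bhattacharyya (rmJoint W m) (rmInput A) (rmObserved A)

/-- `δ_n = poly(1/n)`: the sequence decays at most polynomially, i.e. there are `c > 0` and `d` with
`δ_n ≥ c n^{-d}` for all large `n`. -/
def IsPolyInv (δ : ℕ → ℝ) : Prop :=
  ∃ c : ℝ, 0 < c ∧ ∃ d : ℕ, ∀ᶠ n : ℕ in Filter.atTop, c / (n : ℝ) ^ d ≤ δ n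

/-! ### The Bhattacharyya parameter on finite probability spaces -/

/-! Splitting the cube along the coordinate `z i` turns the Reed–Muller transform into one polar
step applied to two independent smaller transforms: `A` (with `i ∉ A`) and `insert i A` are the good
and bad synthesized bits of a common half-size bit. If `ζ` is the Bhattacharyya parameter of that
bit, the polar step and the Reed–Muller order give `Z_A ≤ ζ ^ 2` and `ζ ≤ Z_{A ∪ {i}}`, hence
`rmZ_le_rmZ_insert_sq`. So `-log Z` at least doubles when passing to a strict subset.

For an unpolarized `A`, `rmZ_le_rmH` bounds `Z_A` away from `1`, while `δ` bounds it below by an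
inverse power of `2 ^ m`. Thus `-log Z_A` lies between a positive constant and `O(m)`, a range of
`O(log m)` dyadic scales. Sets on one scale form an antichain, so Sperner's theorem allows at most
`m.choose (m / 2) ≤ 2 ^ m / √m` of them. The factor `log m` is absorbed by `m ^ γ`, and no constant
depends on the channel. -/

theorem sum_zmod_two {M : Type*} [AddCommMonoid M] (f : ZMod 2 → M) : ∑ s, f s = f 0 + f 1 :=
  Fin.sum_univ_two f

section Bhattacharyya

variable {Ω Ω' S T T' : Type*} [Fintype Ω] [Fintype Ω']

theorem probEq_nonneg {p : Ω → ℝ} (hp : ∀ ω, 0 ≤ p ω) (X : Ω → S) (s : S) : 0 ≤ probEq p X s :=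
  Finset.sum_nonneg fun ω _ => hp ω

open Classical in
theorem probEq_eq_sum_ite (p : Ω → ℝ) (X : Ω → S) (s : S) :
    probEq p X s = ∑ ω, if X ω = s then p ω else 0 := by
  rw [probEq, Finset.sum_filter]

theorem sum_probEq [Fintype S] (p : Ω → ℝ) (X : Ω → S) : ∑ s, probEq p X s = ∑ ω, p ω := by
  classical
  simp only [probEq_eq_sum_ite]
  rw [Finset.sum_comm]
  simp

theorem probEq_eq_sum_pair [Fintype T] (p : Ω → ℝ) (X : Ω → S) (Y : Ω → T) (s : S) :
    probEq p X s = ∑ t, probEq p (fun ω => (X ω, Y ω)) (s, t) := by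
  classical
  simp only [probEq_eq_sum_ite]
  rw [Finset.sum_comm]
  refine Finset.sum_congr rfl fun ω _ => ?_
  simp [Prod.ext_iff, ite_and]

theorem probEq_eq_sum_pair_left [Fintype S] (p : Ω → ℝ) (X : Ω → S) (Y : Ω → T) (t : T) :
    probEq p Y t = ∑ s, probEq p (fun ω => (X ω, Y ω)) (s, t) := by
  classical
  simp only [probEq_eq_sum_ite]
  rw [Finset.sum_comm]
  refine Finset.sum_congr rfl fun ω _ => ?_
  by_cases h : Y ω = t <;> simp [Prod.ext_iff, h]

open Classical in
theorem probEq_pair_comp [Fintype T'] (p : Ω → ℝ) (X : Ω → S) (Y : Ω → T') (f : T' → T) (s : S) (t : T) :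
    probEq p (fun ω => (X ω, f (Y ω))) (s, t) =
      ∑ t' with f t' = t, probEq p (fun ω => (X ω, Y ω)) (s, t') := by
  simp only [probEq_eq_sum_ite]
  rw [Finset.sum_comm]
  refine Finset.sum_congr rfl fun ω _ => ?_
  by_cases h : X ω = s <;> simp [Prod.ext_iff, h, Finset.sum_ite_eq]

theorem probEq_comp_bijective {p : Ω → ℝ} {q : Ω' → ℝ} {Φ : Ω → Ω'} (hΦ : Function.Bijective Φ)
    (hpq : ∀ ω, p ω = q (Φ ω)) (X : Ω' → S) (s : S) :
    probEq p (fun ω => X (Φ ω)) s = probEq q X s := by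
  classical
  simp only [probEq_eq_sum_ite]
  exact hΦ.sum_comp (fun ω => if X ω = s then q ω else 0) ▸
    Finset.sum_congr rfl fun ω _ => by rw [hpq]

theorem bhattacharyya_comp_bijective [Fintype T] {p : Ω → ℝ} {q : Ω' → ℝ} {Φ : Ω → Ω'}
    (hΦ : Function.Bijective Φ) (hpq : ∀ ω, p ω = q (Φ ω)) (X : Ω' → ZMod 2) (Y : Ω' → T) :
    bhattacharyya p (fun ω => X (Φ ω)) (fun ω => Y (Φ ω)) = bhattacharyya q X Y := by
  simp only [bhattacharyya, probEq_comp_bijective hΦ hpq X,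
    probEq_comp_bijective hΦ hpq (fun ω => (X ω, Y ω))]

theorem bhattacharyya_nonneg [Fintype T] (p : Ω → ℝ) (X : Ω → ZMod 2) (Y : Ω → T) :
    0 ≤ bhattacharyya p X Y :=
  Finset.sum_nonneg fun _ _ => Real.sqrt_nonneg _

/-- Cauchy–Schwarz on each fibre of `f`: merging outcomes can only increase the parameter. -/
theorem bhattacharyya_le_comp [Fintype T] [Fintype T'] {p : Ω → ℝ} (hp : ∀ ω, 0 ≤ p ω) (X : Ω → ZMod 2) (Y : Ω → T')
    (f : T' → T) : bhattacharyya p X Y ≤ bhattacharyya p X (fun ω => f (Y ω)) := by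
  classical
  unfold bhattacharyya
  rw [← Finset.sum_fiberwise_of_maps_to (s := Finset.univ) (t := Finset.univ) (g := f)
    (fun _ _ => Finset.mem_univ _)]
  refine Finset.sum_le_sum fun t _ => ?_
  simp only [fun s => probEq_pair_comp p X Y f s t, Finset.sum_div]
  have h0 : ∀ s (t' : T'), 0 ≤ probEq p (fun ω => (X ω, Y ω)) (s, t') / probEq p X s := fun s t' =>
    div_nonneg (probEq_nonneg hp _ _) (probEq_nonneg hp _ _)
  rw [Real.sqrt_mul (Finset.sum_nonneg fun _ _ => h0 _ _)]
  simp only [Real.sqrt_mul (h0 _ _)]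
  exact Real.sum_sqrt_mul_sqrt_le _ (fun _ => h0 _ _) (fun _ => h0 _ _)

/-- More observations decrease the Bhattacharyya parameter. -/
theorem bhattacharyya_le_of_factors [Fintype T] [Fintype T'] {p : Ω → ℝ} (hp : ∀ ω, 0 ≤ p ω) (X : Ω → ZMod 2) (Y : Ω → T')
    (Y' : Ω → T) (h : ∀ ω ω', Y ω = Y ω' → Y' ω = Y' ω') :
    bhattacharyya p X Y ≤ bhattacharyya p X Y' := by
  rcases isEmpty_or_nonempty Ω with hΩ | ⟨⟨ω₀⟩⟩
  · simp [bhattacharyya, probEq]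
  · have : Nonempty T := ⟨Y' ω₀⟩
    obtain ⟨f, hf⟩ := (Function.factorsThrough_iff Y').1 h
    rw [hf]
    exact bhattacharyya_le_comp hp X Y f

theorem sqrt_half_half (a b : ℝ) :
    √(a / (1 / 2) * (b / (1 / 2))) = 2 * √(a * b) := by
  rw [show a / (1 / 2) * (b / (1 / 2)) = 2 ^ 2 * (a * b) by ring, Real.sqrt_mul (by norm_num),
    Real.sqrt_sq (by norm_num)]

theorem bhattacharyya_of_uniform [Fintype T] {p : Ω → ℝ} {X : Ω → ZMod 2} (Y : Ω → T)
    (hX : ∀ s, probEq p X s = 1 / 2) :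
    bhattacharyya p X Y = 2 * ∑ t, √(probEq p (fun ω => (X ω, Y ω)) (0, t) *
      probEq p (fun ω => (X ω, Y ω)) (1, t)) := by
  rw [bhattacharyya, Finset.mul_sum]
  refine Finset.sum_congr rfl fun t _ => ?_
  rw [hX, hX, sqrt_half_half]

theorem sum_eq_one_of_uniform {p : Ω → ℝ} {X : Ω → ZMod 2} (hX : ∀ s, probEq p X s = 1 / 2) :
    ∑ ω, p ω = 1 := by
  rw [← sum_probEq p X, sum_zmod_two, hX, hX]
  norm_num

/-- Both sides are compared with `(1 + 4 * x * y) / 2`: the left by AM–GM, the right through `log (2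
* x) ≤ 2 * x - 1`. -/
theorem negMulLog_add_le {x y : ℝ} (hx : 0 ≤ x) (hy : 0 ≤ y) (hxy : x + y = 1) :
    2 * √(x * y) ≤ 1 - Real.log 2 / 2 +
      (Real.negMulLog x + Real.negMulLog y) / 2 := by
  have key : ∀ x : ℝ, 0 ≤ x → x * Real.log 2 - x * (2 * x - 1) ≤ Real.negMulLog x := by
    intro x hx
    rcases hx.eq_or_lt with rfl | h
    · simp
    · have := Real.log_le_sub_one_of_pos (show 0 < 2 * x by linarith)
      rw [Real.log_mul (by norm_num) h.ne'] at this
      rw [Real.negMulLog]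
      nlinarith
  have h1 := key x hx
  have h2 := key y hy
  have h3 : 2 * √(x * y) ≤ (1 + 4 * (x * y)) / 2 := by
    have := Real.sq_sqrt (mul_nonneg hx hy)
    nlinarith [sq_nonneg (2 * √(x * y) - 1)]
  obtain rfl : y = 1 - x := by linarith
  nlinarith

/-- Averages `negMulLog_add_le` over `t`, with `x` and `y` the posterior probabilities of the two
bit values. -/
theorem bhattacharyya_le_condEntropy [Fintype T] {p : Ω → ℝ} (hp : ∀ ω, 0 ≤ p ω) {X : Ω → ZMod 2} (Y : Ω → T)
    (hX : ∀ s, probEq p X s = 1 / 2) :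
    bhattacharyya p X Y ≤ 1 - Real.log 2 / 2 * (1 - condEntropy p X Y) := by
  have hl : 0 < Real.log 2 := Real.log_pos (by norm_num)
  have htot : ∑ t, probEq p Y t = 1 := by rw [sum_probEq, sum_eq_one_of_uniform hX]
  have hR : 1 - Real.log 2 / 2 * (1 - condEntropy p X Y) =
      ∑ t, probEq p Y t * (1 - Real.log 2 / 2 + (∑ s, Real.negMulLog
        (probEq p (fun ω => (X ω, Y ω)) (s, t) / probEq p Y t)) / 2) := by
    simp only [mul_add, Finset.sum_add_distrib, ← Finset.sum_mul, htot]
    rw [condEntropy, mul_sub, Finset.mul_sum, one_mul, mul_one, sub_sub_eq_add_sub, add_sub_right_comm]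
    congr 1
    refine Finset.sum_congr rfl fun t _ => ?_
    rw [← Finset.sum_div]
    field_simp
  rw [hR, bhattacharyya_of_uniform Y hX, Finset.mul_sum]
  refine Finset.sum_le_sum fun t _ => ?_
  have hsum := probEq_eq_sum_pair_left p X Y t
  rw [sum_zmod_two] at hsum
  rw [sum_zmod_two]
  have ha := probEq_nonneg hp (fun ω => (X ω, Y ω)) (0, t)
  have hb := probEq_nonneg hp (fun ω => (X ω, Y ω)) (1, t)
  generalize probEq p (fun ω => (X ω, Y ω)) (0, t) = a at *
  generalize probEq p (fun ω => (X ω, Y ω)) (1, t) = b at *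
  generalize probEq p Y t = P at *
  -- An outcome of probability zero has no posterior and contributes zero to both sides.
  rcases (add_nonneg ha hb).eq_or_lt with h | h
  · obtain rfl : a = 0 := by linarith
    obtain rfl : b = 0 := by linarith
    simp [hsum]
  · rw [← hsum] at h
    have := negMulLog_add_le (div_nonneg ha h.le) (div_nonneg hb h.le)
      (by rw [← add_div, ← hsum, div_self h.ne'])
    refine le_trans (le_of_eq ?_) (mul_le_mul_of_nonneg_left this h.le)
    rw [show a / P * (b / P) = a * b / P ^ 2 by ring, Real.sqrt_div (mul_nonneg ha hb),
      Real.sqrt_sq h.le]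
    field_simp

theorem bhattacharyya_le_one [Fintype T] {p : Ω → ℝ} (hp : ∀ ω, 0 ≤ p ω) {X : Ω → ZMod 2} (Y : Ω → T)
    (hX : ∀ s, probEq p X s = 1 / 2) : bhattacharyya p X Y ≤ 1 := by
  have h := bhattacharyya_le_comp hp X Y (fun _ => ())
  refine h.trans ?_
  simp only [bhattacharyya, Finset.univ_unique, Finset.sum_singleton]
  have e : ∀ s, probEq p (fun ω => (X ω, ())) (s, ()) = 1 / 2 := fun s => by
    rw [← hX s, probEq_eq_sum_pair p X (fun _ => ())]
    simp
  have e' : (default : Unit) = () := rfl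
  rw [e', e, e, hX, hX]
  norm_num

end Bhattacharyya

/-! ### The polar transform of two independent copies -/

section PolarTransform

variable {Ω T : Type*} [Fintype Ω]

theorem probEq_prod {S S' : Type*} (q : Ω → ℝ) (X : Ω → S) (Y : Ω → S') (s : S) (s' : S') :
    probEq (fun ω : Ω × Ω => q ω.1 * q ω.2) (fun ω => (X ω.1, Y ω.2)) (s, s') =
      probEq q X s * probEq q Y s' := by
  classical
  simp only [probEq_eq_sum_ite]
  rw [Fintype.sum_prod_type, Finset.sum_mul_sum]
  refine Finset.sum_congr rfl fun ω _ => Finset.sum_congr rfl fun ω' _ => ?_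
  by_cases h : X ω = s <;> by_cases h' : Y ω' = s' <;> simp [Prod.ext_iff, h, h']

theorem probEq_congr {S S' : Type*} (p : Ω → ℝ) (X : Ω → S) (Y : Ω → S') (s : S) (s' : S')
    (h : ∀ ω, X ω = s ↔ Y ω = s') : probEq p X s = probEq p Y s' := by
  classical
  simp only [probEq_eq_sum_ite, h]

variable {q : Ω → ℝ} {V : Ω → ZMod 2}

theorem probEq_prod_fst (hV : ∀ s, probEq q V s = 1 / 2) (s : ZMod 2) :
    probEq (fun ω : Ω × Ω => q ω.1 * q ω.2) (fun ω => V ω.1) s = 1 / 2 := by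
  rw [probEq_eq_sum_pair _ _ (fun ω : Ω × Ω => V ω.2)]
  simp only [probEq_prod, hV]
  rw [sum_zmod_two]
  norm_num

theorem probEq_prod_add (hV : ∀ s, probEq q V s = 1 / 2) (s : ZMod 2) :
    probEq (fun ω : Ω × Ω => q ω.1 * q ω.2) (fun ω => V ω.1 + V ω.2) s = 1 / 2 := by
  rw [probEq_eq_sum_pair _ _ (fun ω : Ω × Ω => V ω.2)]
  have : ∀ t, probEq (fun ω : Ω × Ω => q ω.1 * q ω.2) (fun ω => (V ω.1 + V ω.2, V ω.2)) (s, t) =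
      1 / 2 * (1 / 2) := fun t => by
    rw [probEq_congr _ _ (fun ω : Ω × Ω => (V ω.1, V ω.2)) _ (s - t, t), probEq_prod, hV, hV]
    intro ω
    simp only [Prod.ext_iff, eq_sub_iff_add_eq]
    constructor <;> rintro ⟨h, rfl⟩ <;> simp [h]
  simp only [this]
  rw [sum_zmod_two]
  norm_num

/-- For either value of `V ω.1 + V ω.2`, the term under the root splits into one factor per copy.
The two values contribute equally, so the double sum factors. -/
theorem bhattacharyya_polar_plus [Fintype T] (hq : ∀ ω, 0 ≤ q ω)
    (hV : ∀ s, probEq q V s = 1 / 2) (Y : Ω → T) :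
    bhattacharyya (fun ω : Ω × Ω => q ω.1 * q ω.2) (fun ω => V ω.1)
      (fun ω => (V ω.1 + V ω.2, Y ω.1, Y ω.2)) = bhattacharyya q V Y ^ 2 := by
  rw [bhattacharyya_of_uniform _ (probEq_prod_fst hV),
    bhattacharyya_of_uniform _ hV]
  set P : ZMod 2 → T → ℝ := fun s t => probEq q (fun ω => (V ω, Y ω)) (s, t) with hP
  have hP0 : ∀ s t, 0 ≤ P s t := fun s t => probEq_nonneg hq _ _
  have e : ∀ (a s : ZMod 2) (t t' : T),
      probEq (fun ω : Ω × Ω => q ω.1 * q ω.2)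
        (fun ω => (V ω.1, V ω.1 + V ω.2, Y ω.1, Y ω.2)) (a, s, t, t') = P a t * P (s - a) t' := by
    intro a s t t'
    rw [hP, ← probEq_prod]
    refine probEq_congr _ _ _ _ _ fun ω => ?_
    simp only [Prod.ext_iff, eq_sub_iff_add_eq']
    constructor
    · rintro ⟨rfl, h, h', h''⟩; exact ⟨⟨rfl, h'⟩, h, h''⟩
    · rintro ⟨⟨rfl, h'⟩, h, h''⟩; exact ⟨rfl, h, h', h''⟩
  simp only [Fintype.sum_prod_type, e]
  rw [sum_zmod_two]
  change 2 * ((∑ t, ∑ t', √(P 0 t * P 0 t' * (P 1 t * P 1 t'))) +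
    ∑ t, ∑ t', √(P 0 t * P 1 t' * (P 1 t * P 0 t'))) = _
  have e1 : ∀ t t', √(P 0 t * P 0 t' * (P 1 t * P 1 t')) =
      √(P 0 t * P 1 t) * √(P 0 t' * P 1 t') := fun t t' => by
    rw [← Real.sqrt_mul (mul_nonneg (hP0 _ _) (hP0 _ _))]; congr 1; ring
  have e2 : ∀ t t', √(P 0 t * P 1 t' * (P 1 t * P 0 t')) =
      √(P 0 t * P 1 t) * √(P 0 t' * P 1 t') := fun t t' => by
    rw [← Real.sqrt_mul (mul_nonneg (hP0 _ _) (hP0 _ _))]; congr 1; ring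
  simp only [e1, e2, ← Finset.sum_mul_sum]
  ring

/-- A genie argument: also revealing `V ω.2` can only lower the parameter, and then the sum is a
known shift of `V ω.1`, whose parameter is that of a single copy. -/
theorem bhattacharyya_le_polar_minus [Fintype T] (hq : ∀ ω, 0 ≤ q ω)
    (hV : ∀ s, probEq q V s = 1 / 2) (Y : Ω → T) :
    bhattacharyya q V Y ≤ bhattacharyya (fun ω : Ω × Ω => q ω.1 * q ω.2)
      (fun ω => V ω.1 + V ω.2) (fun ω => (Y ω.1, Y ω.2)) := by
  have hp : ∀ ω : Ω × Ω, 0 ≤ q ω.1 * q ω.2 := fun ω => mul_nonneg (hq _) (hq _)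
  refine le_trans (le_of_eq ?_) (bhattacharyya_le_of_factors hp _
    (fun ω => (Y ω.1, Y ω.2, V ω.2)) _ fun ω ω' h => by simp_all [Prod.ext_iff])
  rw [bhattacharyya_of_uniform _ (probEq_prod_add hV), bhattacharyya_of_uniform _ hV]
  set P : ZMod 2 → T → ℝ := fun s t => probEq q (fun ω => (V ω, Y ω)) (s, t) with hP
  have hP0 : ∀ s t, 0 ≤ P s t := fun s t => probEq_nonneg hq _ _
  have e : ∀ (a b : ZMod 2) (t t' : T),
      probEq (fun ω : Ω × Ω => q ω.1 * q ω.2)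
        (fun ω => (V ω.1 + V ω.2, Y ω.1, Y ω.2, V ω.2)) (a, t, t', b) = P (a - b) t * P b t' := by
    intro a b t t'
    rw [hP, ← probEq_prod]
    refine probEq_congr _ _ _ _ _ fun ω => ?_
    simp only [Prod.ext_iff, eq_sub_iff_add_eq]
    constructor
    · rintro ⟨h, h', h'', rfl⟩; exact ⟨⟨h, h'⟩, rfl, h''⟩
    · rintro ⟨⟨h, h'⟩, rfl, h''⟩; exact ⟨h, h', h'', rfl⟩
  have e1 : ∀ t t' b, √(P (0 - b) t * P b t' * (P (1 - b) t * P b t')) =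
      √(P 0 t * P 1 t) * P b t' := fun t t' b => by
    have : P (0 - b) t * P (1 - b) t = P 0 t * P 1 t := by
      rcases (by decide +revert : b = 0 ∨ b = 1) with rfl | rfl
      · rfl
      · exact mul_comm _ _
    rw [show P (0 - b) t * P b t' * (P (1 - b) t * P b t') =
      P (0 - b) t * P (1 - b) t * P b t' ^ 2 by ring, this,
      Real.sqrt_mul (mul_nonneg (hP0 _ _) (hP0 _ _)), Real.sqrt_sq (hP0 _ _)]
  have h1 : ∑ t', ∑ b, P b t' = 1 := by
    simp only [hP, ← probEq_eq_sum_pair_left]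
    rw [sum_probEq, sum_eq_one_of_uniform hV]
  simp only [Fintype.sum_prod_type, e, e1, ← Finset.mul_sum, h1, mul_one]
  rfl

end PolarTransform

/-! ### The Reed-Muller order under insertion of a common element -/

theorem List.orderedInsert_lt_orderedInsert {α : Type*} [LinearOrder α] (i : α) :
    ∀ {l l' : List α}, l < l' → l.orderedInsert (· ≥ ·) i < l'.orderedInsert (· ≥ ·) i
  | [], [], h => absurd h (lt_irrefl _)
  | _ :: _, [], h => absurd h (List.not_lt_nil _)
  | [], b :: l', _ => by
    simp only [List.orderedInsert_nil, List.orderedInsert_cons]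
    split_ifs with hb
    · exact List.Lex.cons List.Lex.nil
    · exact List.Lex.rel (not_le.1 hb)
  | a :: l, b :: l', h => by
    simp only [List.orderedInsert_cons]
    rcases List.cons_lt_cons_iff.1 h with hab | ⟨rfl, hl⟩
    · split_ifs with h1 h2 h2
      · exact List.Lex.cons h
      · exact List.Lex.rel (not_le.1 h2)
      · exact absurd (hab.le.trans h2) h1
      · exact List.Lex.rel hab
    · split_ifs with h1
      · exact List.Lex.cons h
      · exact List.Lex.cons (List.orderedInsert_lt_orderedInsert i hl)

theorem Finset.sort_ge_insert {α : Type*} [LinearOrder α] {i : α} {A : Finset α} (hi : i ∉ A) :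
    (insert i A).sort (· ≥ ·) = (A.sort (· ≥ ·)).orderedInsert (· ≥ ·) i := by
  refine List.Perm.eq_of_pairwise' (r := (· ≥ ·)) (Finset.pairwise_sort _ _)
    (List.Pairwise.orderedInsert _ _ (Finset.pairwise_sort _ _)) ?_
  refine List.Perm.trans ?_ (List.perm_orderedInsert _ _ _).symm
  rw [← Multiset.coe_eq_coe, Finset.sort_eq, ← Multiset.cons_coe, Finset.sort_eq,
    Finset.insert_val_of_notMem hi]

/-- Inserting a common element is strictly increasing on decreasing lists; totality of the
lexicographic order then lets the insertion be cancelled. -/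
theorem rmLT_of_insert {m : ℕ} {i : Fin m} {A B : Finset (Fin m)} (hA : i ∉ A) (hB : i ∉ B)
    (h : rmLT (insert i B) (insert i A)) : rmLT B A := by
  rcases h with h | ⟨hc, hl⟩
  · left
    rwa [Finset.card_insert_of_notMem hA, Finset.card_insert_of_notMem hB, add_lt_add_iff_right] at h
  · rw [Finset.card_insert_of_notMem hA, Finset.card_insert_of_notMem hB, add_left_inj] at hc
    refine Or.inr ⟨hc.symm ▸ rfl, ?_⟩
    by_contra hlt
    rw [Finset.sort_ge_insert hA, Finset.sort_ge_insert hB] at hl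
    rcases (not_lt.1 hlt).eq_or_lt with h | h
    · rw [h] at hl
      exact lt_irrefl _ hl
    · exact lt_asymm hl (List.orderedInsert_lt_orderedInsert i h)

theorem rmLT_of_rmLT_insert {m : ℕ} {i : Fin m} {A B : Finset (Fin m)} (hA : i ∉ A)
    (h : rmLT B (insert i A)) : rmLT B A := by
  left
  have : (insert i A).card ≤ B.card := h.elim (·.le) (·.1.ge)
  rw [Finset.card_insert_of_notMem hA] at this
  omega

theorem rmLT_insert_of_rmLT {m : ℕ} {i : Fin m} {A B : Finset (Fin m)} (hB : i ∉ B)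
    (h : rmLT B A) : rmLT (insert i B) A := by
  left
  have : A.card ≤ B.card := h.elim (·.le) (·.1.ge)
  rw [Finset.card_insert_of_notMem hB]
  omega

theorem rmLT_insert_self {m : ℕ} {i : Fin m} {A : Finset (Fin m)} (hA : i ∉ A) :
    rmLT (insert i A) A := by
  left
  rw [Finset.card_insert_of_notMem hA]
  omega

/-! ### Splitting the Reed-Muller transform along a coordinate -/

section Split

variable {k : ℕ} (i : Fin (k + 1))

/-- The image of a subset of `Fin k` in `Fin (k + 1)` under the embedding that misses `i`. -/
def liftSet (C : Finset (Fin k)) : Finset (Fin (k + 1)) := C.map i.succAboveEmb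

theorem notMem_liftSet (C : Finset (Fin k)) : i ∉ liftSet i C := by
  simp [liftSet, Fin.succAbove_ne]

theorem exists_liftSet_eq {A : Finset (Fin (k + 1))} (hA : i ∉ A) : ∃ C, liftSet i C = A := by
  refine ⟨Finset.univ.filter fun j => i.succAbove j ∈ A, ?_⟩
  ext j
  simp only [liftSet, Finset.mem_map, Finset.mem_filter, Finset.mem_univ, true_and,
    Fin.coe_succAboveEmb]
  refine ⟨by rintro ⟨_, h, rfl⟩; exact h, fun h => ?_⟩
  obtain ⟨l, rfl⟩ := Fin.exists_succAbove_eq (fun e : j = i => hA (e ▸ h))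
  exact ⟨l, h, rfl⟩

theorem exists_liftSet_or_insert (A : Finset (Fin (k + 1))) :
    ∃ C, A = liftSet i C ∨ A = insert i (liftSet i C) := by
  by_cases hA : i ∈ A
  · obtain ⟨C, hC⟩ := exists_liftSet_eq i (Finset.notMem_erase i A)
    exact ⟨C, Or.inr (by rw [hC, Finset.insert_erase hA])⟩
  · obtain ⟨C, hC⟩ := exists_liftSet_eq i hA
    exact ⟨C, Or.inl hC.symm⟩

theorem liftSet_injective : Function.Injective (liftSet i) := Finset.map_injective _

theorem sum_eq_sum_liftSet {M : Type*} [AddCommMonoid M] (f : Finset (Fin (k + 1)) → M) :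
    ∑ A, f A = ∑ C, (f (liftSet i C) + f (insert i (liftSet i C))) := by
  refine .trans ?_ ((Fintype.sum_sum_type (Sum.elim (fun C => f (liftSet i C))
    (fun C => f (insert i (liftSet i C))))).trans Finset.sum_add_distrib.symm)
  symm
  refine Fintype.sum_bijective (Sum.elim (liftSet i) fun C => insert i (liftSet i C)) ⟨?_, ?_⟩ _ _ ?_
  · refine (liftSet_injective i).sumElim (fun C D h => liftSet_injective i ?_) fun C D h => ?_
    · rw [← Finset.erase_insert (notMem_liftSet i C), h, Finset.erase_insert (notMem_liftSet i D)]
    · exact notMem_liftSet i C (h ▸ Finset.mem_insert_self _ _)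
  · intro A
    obtain ⟨C, rfl | rfl⟩ := exists_liftSet_or_insert i A
    · exact ⟨Sum.inl C, rfl⟩
    · exact ⟨Sum.inr C, rfl⟩
  · rintro (C | C) <;> rfl

theorem rmRow_liftSet (C : Finset (Fin k)) (b : ZMod 2) (w : Fin k → ZMod 2) :
    rmRow (liftSet i C) (i.insertNth b w) = rmRow C w := by
  simp [rmRow, liftSet]

theorem rmRow_insert_liftSet (C : Finset (Fin k)) (b : ZMod 2) (w : Fin k → ZMod 2) :
    rmRow (insert i (liftSet i C)) (i.insertNth b w) = b * rmRow C w := by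
  rw [← rmRow_liftSet i C b w, rmRow, Finset.prod_insert (notMem_liftSet i C),
    Fin.insertNth_apply_same, rmRow]

/-- The Plotkin `(u, u + v)` structure: monomials containing `i` vanish on `z i = 0` and lose that
factor on `z i = 1`. -/
theorem rmEncode_insertNth (u : Finset (Fin (k + 1)) → ZMod 2) (b : ZMod 2) (w : Fin k → ZMod 2) :
    rmEncode u (i.insertNth b w) =
      rmEncode (fun C => u (liftSet i C) + b * u (insert i (liftSet i C))) w := by
  simp only [rmEncode, sum_eq_sum_liftSet i, rmRow_liftSet, rmRow_insert_liftSet]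
  refine Finset.sum_congr rfl fun C _ => ?_
  ring

/-- The half of a sample on the hyperplane `z i = b`. -/
def halfSample {Y : Type*} (b : ZMod 2) (ω : RMSample (k + 1) Y) : RMSample k Y :=
  (fun C => ω.1 (liftSet i C) + b * ω.1 (insert i (liftSet i C)), fun w => ω.2 (i.insertNth b w))

/-- The two halves of a sample. -/
def splitSample {Y : Type*} (ω : RMSample (k + 1) Y) : RMSample k Y × RMSample k Y :=
  (halfSample i 0 ω, halfSample i 1 ω)

theorem splitSample_injective {Y : Type*} :
    Function.Injective (splitSample (Y := Y) i) := by
  rintro ⟨u, y⟩ ⟨u', y'⟩ h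
  simp only [splitSample, halfSample, Prod.mk.injEq, zero_mul, add_zero, one_mul] at h
  obtain ⟨⟨hu, hy⟩, hu', hy'⟩ := h
  refine Prod.ext (funext fun A => ?_) (funext fun z => ?_)
  · have h1 : ∀ C, u (liftSet i C) = u' (liftSet i C) := congrFun hu
    obtain ⟨C, rfl | rfl⟩ := exists_liftSet_or_insert i A
    · exact h1 C
    · have := congrFun hu' C
      simpa [h1] using this
  · change y z = y' z
    rw [← Fin.insertNth_self_removeNth i z]
    rcases (by decide +revert : ∀ b : ZMod 2, b = 0 ∨ b = 1) (z i) with h | h <;> rw [h]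
    · exact congrFun hy _
    · exact congrFun hy' _

theorem splitSample_bijective {Y : Type*} [Fintype Y] :
    Function.Bijective (splitSample (Y := Y) i) := by
  classical
  refine (Fintype.bijective_iff_injective_and_card _).2 ⟨splitSample_injective i, ?_⟩
  simp only [Fintype.card_prod, Fintype.card_fun, Fintype.card_finset, Fintype.card_fin, ZMod.card]
  ring

theorem prod_eq_prod_insertNth {M : Type*} [CommMonoid M] (f : (Fin (k + 1) → ZMod 2) → M) :
    ∏ z, f z = (∏ w, f (i.insertNth 0 w)) * ∏ w, f (i.insertNth 1 w) := by
  rw [← (Fin.insertNthEquiv (fun _ => ZMod 2) i).prod_comp, Fintype.prod_prod_type]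
  exact Fin.prod_univ_two _

variable {Y : Type*} [Fintype Y] (W : BMSChannel Y)

theorem rmJoint_eq_mul (ω : RMSample (k + 1) Y) :
    rmJoint W (k + 1) ω = rmJoint W k (splitSample i ω).1 * rmJoint W k (splitSample i ω).2 := by
  simp only [rmJoint, prod_eq_prod_insertNth i, rmEncode_insertNth, splitSample, halfSample]
  rw [pow_succ 2 k, pow_mul]
  ring

end Split

/-! ### Uniform inputs and the resulting bounds on `rmZ`. -/

section Uniform

variable {Y : Type*} [Fintype Y] (W : BMSChannel Y) {m : ℕ}

theorem rmJoint_nonneg (ω : RMSample m Y) : 0 ≤ rmJoint W m ω :=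
  mul_nonneg (by positivity) (Finset.prod_nonneg fun _ _ => W.nonneg _ _)

theorem sum_rmJoint (u : Finset (Fin m) → ZMod 2) :
    ∑ y, rmJoint W m (u, y) = (1 / 2 : ℝ) ^ (2 ^ m) := by
  classical
  simp only [rmJoint, ← Finset.mul_sum]
  rw [← Fintype.piFinset_univ, ← Finset.prod_univ_sum (fun _ => Finset.univ)
    (fun z y => W.trans (rmEncode u z) y)]
  simp [W.sum_eq_one]

theorem probEq_rmInput (A : Finset (Fin m)) (s : ZMod 2) :
    probEq (rmJoint W m) (rmInput A) s = 1 / 2 := by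
  classical
  have key : ∀ s, probEq (rmJoint W m) (rmInput A) s =
      ∑ u : Finset (Fin m) → ZMod 2, if u A = s then (1 / 2 : ℝ) ^ (2 ^ m) else 0 := by
    intro s
    rw [probEq_eq_sum_ite, Fintype.sum_prod_type]
    refine Finset.sum_congr rfl fun u _ => ?_
    rw [← sum_rmJoint W u]
    by_cases h : u A = s <;> simp [rmInput, h]
  have hsymm : ∀ s, probEq (rmJoint W m) (rmInput A) s = probEq (rmJoint W m) (rmInput A) 0 := by
    intro s
    rw [key, key]
    symm
    -- Translating the coordinate `A` by `s` carries the event `u A = 0` to `u A = s`.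
    exact Fintype.sum_equiv (Equiv.addRight (Pi.single A s)) _ _ fun u => by simp
  have htot := sum_probEq (rmJoint W m) (rmInput A)
  rw [Fintype.sum_prod_type] at htot
  simp only [sum_rmJoint, hsymm] at htot
  rw [hsymm]
  simp at htot
  linarith

theorem rmZ_nonneg (A : Finset (Fin m)) : 0 ≤ rmZ W A := bhattacharyya_nonneg _ _ _

theorem rmZ_le_one (A : Finset (Fin m)) : rmZ W A ≤ 1 :=
  bhattacharyya_le_one (rmJoint_nonneg W) _ (probEq_rmInput W A)

theorem rmZ_le_rmH (A : Finset (Fin m)) : rmZ W A ≤ 1 - Real.log 2 / 2 * (1 - rmH W A) :=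
  bhattacharyya_le_condEntropy (rmJoint_nonneg W) _ (probEq_rmInput W A)

end Uniform

/-! ### Squaring of the Bhattacharyya parameter. -/

section Polarization

variable {Y : Type*} [Fintype Y] (W : BMSChannel Y)

/-- The channel outputs of a half sample, and its inputs that come before `C` in the order of the
full transform. -/
def halfObserved {k : ℕ} (i : Fin (k + 1)) (C : Finset (Fin k)) (ω : RMSample k Y) :
    ((Fin k → ZMod 2) → Y) × ({D : Finset (Fin k) // rmLT (liftSet i D) (liftSet i C)} → ZMod 2) :=
  (ω.2, fun D => ω.1 D.1)

/-- The bits preceding `liftSet i C` include `insert i (liftSet i C)` and, for each `D` before `C`,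
both bits over `D`. They determine everything observed in the good polar step. -/
theorem rmZ_liftSet_le {k : ℕ} (i : Fin (k + 1)) (C : Finset (Fin k)) :
    rmZ W (liftSet i C) ≤
      bhattacharyya (rmJoint W k) (rmInput C) (halfObserved (Y := Y) i C) ^ 2 := by
  rw [← bhattacharyya_polar_plus (rmJoint_nonneg W) (probEq_rmInput W C) _,
    ← bhattacharyya_comp_bijective (splitSample_bijective i) (rmJoint_eq_mul i W)]
  have hX : (fun ω => rmInput C (splitSample (Y := Y) i ω).1) = rmInput (liftSet i C) := by
    funext ω
    simp [rmInput, splitSample, halfSample]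
  rw [hX]
  refine bhattacharyya_le_of_factors (rmJoint_nonneg W) _ _ _ ?_
  rintro ⟨u, y⟩ ⟨u', y'⟩ h
  simp only [rmObserved, Prod.mk.injEq] at h
  obtain ⟨rfl, h⟩ := h
  have hu : ∀ B, rmLT B (liftSet i C) → u B = u' B := fun B hB => congrFun h ⟨B, hB⟩
  have h1 := hu _ (rmLT_insert_self (notMem_liftSet i C))
  have h2 : ∀ D : {D : Finset (Fin k) // rmLT (liftSet i D) (liftSet i C)},
      u (liftSet i D.1) = u' (liftSet i D.1) := fun D => hu _ D.2
  have h3 : ∀ D : {D : Finset (Fin k) // rmLT (liftSet i D) (liftSet i C)},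
      u (insert i (liftSet i D.1)) = u' (insert i (liftSet i D.1)) :=
    fun D => hu _ (rmLT_insert_of_rmLT (notMem_liftSet i _) D.2)
  have e : ∀ a b : ZMod 2, a + (a + b) = b := by decide
  simp [rmInput, halfObserved, splitSample, halfSample, h1, h2, h3, e]

/-- Conversely, every bit preceding `insert i (liftSet i C)` lies over some `D` before `C`, so the
two half observations already determine it. -/
theorem le_rmZ_insert_liftSet {k : ℕ} (i : Fin (k + 1)) (C : Finset (Fin k)) :
    bhattacharyya (rmJoint W k) (rmInput C) (halfObserved (Y := Y) i C) ≤
      rmZ W (insert i (liftSet i C)) := by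
  refine (bhattacharyya_le_polar_minus (rmJoint_nonneg W) (probEq_rmInput W C) _).trans ?_
  rw [← bhattacharyya_comp_bijective (splitSample_bijective i) (rmJoint_eq_mul i W)]
  have e : ∀ a b : ZMod 2, a + (a + b) = b := by decide
  have hX : (fun ω => rmInput C (splitSample (Y := Y) i ω).1 +
      rmInput C (splitSample (Y := Y) i ω).2) = rmInput (insert i (liftSet i C)) := by
    funext ω
    simp [rmInput, splitSample, halfSample, e]
  rw [hX]
  refine bhattacharyya_le_of_factors (rmJoint_nonneg W) _ _ _ ?_
  rintro ⟨u, y⟩ ⟨u', y'⟩ h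
  simp only [halfObserved, splitSample, halfSample, Prod.mk.injEq, zero_mul, add_zero, one_mul] at h
  obtain ⟨⟨hy, hu⟩, hy', hu'⟩ := h
  have h1 : ∀ D, rmLT (liftSet i D) (liftSet i C) → u (liftSet i D) = u' (liftSet i D) :=
    fun D hD => congrFun hu ⟨D, hD⟩
  refine Prod.ext (funext fun z => ?_) (funext fun ⟨B, hB⟩ => ?_)
  · change y z = y' z
    rw [← Fin.insertNth_self_removeNth i z]
    rcases (by decide +revert : ∀ b : ZMod 2, b = 0 ∨ b = 1) (z i) with h | h <;> rw [h]
    · exact congrFun hy _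
    · exact congrFun hy' _
  · change u B = u' B
    obtain ⟨D, rfl | rfl⟩ := exists_liftSet_or_insert i B
    · exact h1 D (rmLT_of_rmLT_insert (notMem_liftSet i C) hB)
    · have hD := rmLT_of_insert (notMem_liftSet i C) (notMem_liftSet i D) hB
      simpa [h1 D hD] using congrFun hu' ⟨D, hD⟩

/-- Removing an element from `A` squares the Bhattacharyya parameter. -/
theorem rmZ_le_rmZ_insert_sq {m : ℕ} {i : Fin m} {A : Finset (Fin m)} (hi : i ∉ A) :
    rmZ W A ≤ rmZ W (insert i A) ^ 2 := by
  obtain _ | k := m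
  · exact i.elim0
  · obtain ⟨C, rfl⟩ := exists_liftSet_eq i hi
    exact (rmZ_liftSet_le W i C).trans
      (pow_le_pow_left₀ (bhattacharyya_nonneg _ _ _) (le_rmZ_insert_liftSet W i C) 2)

theorem rmZ_mono {m : ℕ} : Monotone (rmZ W (m := m)) :=
  Finset.monotone_iff_forall_le_insert.2 fun _ _ hi => (rmZ_le_rmZ_insert_sq W hi).trans
    (pow_le_of_le_one (rmZ_nonneg W _) (rmZ_le_one W _) two_ne_zero)

theorem rmZ_le_sq_of_ssubset {m : ℕ} {A B : Finset (Fin m)} (h : A ⊂ B) :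
    rmZ W A ≤ rmZ W B ^ 2 := by
  obtain ⟨i, hi, hiB⟩ := Finset.ssubset_iff.1 h
  exact (rmZ_le_rmZ_insert_sq W hi).trans
    (pow_le_pow_left₀ (rmZ_nonneg W _) (rmZ_mono W hiB) 2)

end Polarization

/-! ### Counting -/

theorem Nat.centralBinom_sq_mul_le (n : ℕ) : n.centralBinom ^ 2 * (2 * n + 1) ≤ 16 ^ n := by
  induction n with
  | zero => simp
  | succ n ih =>
    have h := Nat.succ_mul_centralBinom_succ n
    refine le_of_mul_le_mul_left (a := (n + 1) ^ 2) ?_ (pow_pos n.succ_pos 2)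
    calc (n + 1) ^ 2 * ((n + 1).centralBinom ^ 2 * (2 * (n + 1) + 1))
        = ((n + 1) * (n + 1).centralBinom) ^ 2 * (2 * n + 3) := by ring
      _ = 4 * (2 * n + 1) * (2 * n + 3) * (n.centralBinom ^ 2 * (2 * n + 1)) := by rw [h]; ring
      _ ≤ 4 * (2 * n + 1) * (2 * n + 3) * 16 ^ n := Nat.mul_le_mul_left _ ih
      -- This is `(2 * n + 1) * (2 * n + 3) ≤ (2 * n + 2) ^ 2`.
      _ ≤ 16 * (n + 1) ^ 2 * 16 ^ n := Nat.mul_le_mul_right _ (by nlinarith)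
      _ = (n + 1) ^ 2 * 16 ^ (n + 1) := by ring

theorem Nat.choose_half_sq_mul_le (m : ℕ) : m.choose (m / 2) ^ 2 * (m + 1) ≤ 4 ^ m := by
  obtain ⟨k, rfl | rfl⟩ := Nat.even_or_odd' m
  · have h := Nat.centralBinom_sq_mul_le k
    rw [Nat.centralBinom_eq_two_mul_choose] at h
    rwa [Nat.mul_div_cancel_left k two_pos, pow_mul]
  · have h := Nat.centralBinom_sq_mul_le (k + 1)
    rw [Nat.centralBinom_eq_two_mul_choose, show 2 * (k + 1) = 2 * k + 1 + 1 by ring,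
      Nat.choose_succ_succ, Nat.succ_eq_add_one, Nat.choose_symm_half] at h
    rw [show (2 * k + 1) / 2 = k by omega]
    have e : (4 : ℕ) ^ (2 * k + 1) * 4 = 16 ^ (k + 1) := by
      rw [pow_succ, pow_mul]
      ring
    nlinarith [sq_nonneg ((2 * k + 1).choose k)]

theorem choose_half_le (m : ℕ) (hm : 0 < m) :
    (m.choose (m / 2) : ℝ) ≤ 2 ^ m * (m : ℝ) ^ (-(1 / 2) : ℝ) := by
  have h : ((m.choose (m / 2) : ℝ)) ^ 2 * (m + 1) ≤ 4 ^ m := by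
    exact_mod_cast Nat.choose_half_sq_mul_le m
  have hm' : (0 : ℝ) < m := by exact_mod_cast hm
  rw [Real.rpow_neg hm'.le, ← Real.sqrt_eq_rpow, ← div_eq_mul_inv, le_div_iff₀ (by positivity)]
  refine (sq_le_sq₀ (by positivity) (by positivity)).1 ?_
  rw [mul_pow, Real.sq_sqrt hm'.le, ← pow_mul, mul_comm m, pow_mul]
  norm_num
  nlinarith [sq_nonneg (m.choose (m / 2) : ℝ)]

/-- Each fibre of `f` on `S` is an antichain, so Sperner's theorem bounds it. -/
theorem Finset.card_le_mul_choose_of_level {m K : ℕ} (S : Finset (Finset (Fin m)))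
    (f : Finset (Fin m) → ℕ) (hK : ∀ A ∈ S, f A < K)
    (hf : ∀ A ∈ S, ∀ B ∈ S, A ⊂ B → f A ≠ f B) : S.card ≤ m.choose (m / 2) * K := by
  have := Finset.card_le_mul_card_image_of_maps_to (s := S) (f := f) (t := Finset.range K)
    (fun A hA => Finset.mem_range.2 (hK A hA)) (m.choose (m / 2)) fun b _ => ?_
  · rwa [Finset.card_range] at this
  · have hanti : IsAntichain (· ⊆ ·) (SetLike.coe {A ∈ S | f A = b}) := by
      intro A hA B hB hne hAB
      simp only [Finset.coe_filter, Set.mem_ofPred_eq] at hA hB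
      exact hf A hA.1 B hB.1 (hAB.ssubset_of_ne hne) (hA.2.trans hB.2.symm)
    simpa using hanti.sperner

theorem Nat.log_two_floor_lt {x y : ℝ} (hx : 1 ≤ x) (hxy : 2 * x ≤ y) :
    Nat.log 2 ⌊x⌋₊ < Nat.log 2 ⌊y⌋₊ := by
  have h1 : ⌊x⌋₊ ≠ 0 := (Nat.floor_pos.2 hx).ne'
  have h2 : ⌊x⌋₊ * 2 ≤ ⌊y⌋₊ := by
    refine Nat.le_floor ?_
    push_cast
    linarith [Nat.floor_le (show 0 ≤ x by linarith)]
  calc Nat.log 2 ⌊x⌋₊ < Nat.log 2 (⌊x⌋₊ * 2) := by rw [Nat.log_mul_base one_lt_two h1]; omega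
    _ ≤ _ := Nat.log_mono_right h2

/-- The number of dyadic scales is `O(log m)`, hence `o(m ^ γ)`. -/
theorem eventually_log_floor_le (C : ℝ) (hC : 1 ≤ C) (γ : ℝ) (hγ : 0 < γ) :
    ∀ᶠ m : ℕ in Filter.atTop, ((Nat.log 2 ⌊C * m⌋₊ + 1 : ℕ) : ℝ) ≤ (m : ℝ) ^ γ := by
  have hl : 0 < Real.log 2 := Real.log_pos one_lt_two
  have h1 : (fun x : ℝ => (Real.log C / Real.log 2 + 1) + (Real.log 2)⁻¹ * Real.log x)
      =o[Filter.atTop] fun x : ℝ => x ^ γ := by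
    refine Asymptotics.IsLittleO.add ?_ ((isLittleO_log_rpow_atTop hγ).const_mul_left _)
    refine Asymptotics.isLittleO_const_left.2 (Or.inr ?_)
    exact tendsto_norm_atTop_atTop.comp (tendsto_rpow_atTop hγ)
  have h2 := (h1.bound one_pos).natCast_atTop
  filter_upwards [h2, Filter.eventually_ge_atTop 1] with m hm hm1
  have hm0 : (1 : ℝ) ≤ m := by exact_mod_cast hm1
  have hCm : 1 ≤ C * m := by nlinarith
  have h3 : (0 : ℝ) < ⌊C * m⌋₊ := by exact_mod_cast Nat.floor_pos.2 hCm
  have h4 := Real.log_le_log h3 (Nat.floor_le (by linarith))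
  rw [Real.log_mul (by linarith) (by linarith)] at h4
  have h5 := Real.natLog_le_logb ⌊C * m⌋₊ 2
  rw [Real.logb, le_div_iff₀ (by simpa using hl)] at h5
  have h6 := (le_abs_self _).trans hm
  rw [Real.norm_of_nonneg (by positivity), one_mul] at h6
  refine le_trans ?_ h6
  push_cast at h5 ⊢
  have : (Nat.log 2 ⌊C * m⌋₊ : ℝ) ≤ (Real.log C + Real.log m) / Real.log 2 := by
    rw [le_div_iff₀ hl]
    exact h5.trans h4
  refine (add_le_add_left this 1).trans (le_of_eq ?_)
  field_simp
  ring

/-! ### Counting unpolarized sets and conclusion. -/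

theorem card_unpolarized_le {Y : Type*} [Fintype Y] (W : BMSChannel Y) {m : ℕ} {η D C : ℝ}
    (hη : 0 < η) (hD : 0 < D) (hC : -Real.log D ≤ η * C) (S : Finset (Finset (Fin m)))
    (hS : ∀ A ∈ S, rmZ W A ≤ 1 - η ∧ D ≤ rmZ W A) :
    S.card ≤ m.choose (m / 2) * (Nat.log 2 ⌊C⌋₊ + 1) := by
  have hpos : ∀ A ∈ S, 0 < rmZ W A := fun A hA => hD.trans_le (hS A hA).2
  -- The level is the dyadic scale of `-log Z / η`. Dividing by `η` makes this ratio at least `1` on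
  -- `S`, since `-log Z ≥ 1 - Z ≥ η`; the floor is then positive and doubling strictly raises the
  -- level.
  refine Finset.card_le_mul_choose_of_level S (fun A => Nat.log 2 ⌊-Real.log (rmZ W A) / η⌋₊)
    (fun A hA => Nat.lt_succ_of_le (Nat.log_mono_right (Nat.floor_le_floor ?_)))
    fun A hA B hB hAB => (Nat.log_two_floor_lt ?_ ?_).ne'
  · rw [div_le_iff₀ hη]
    linarith [Real.log_le_log hD (hS A hA).2]
  · rw [le_div_iff₀ hη]
    linarith [Real.log_le_sub_one_of_pos (hpos B hB), (hS B hB).1]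
  · have h := Real.log_le_log (hpos A hA) (rmZ_le_sq_of_ssubset W hAB)
    rw [Real.log_pow] at h
    push_cast at h
    rw [← mul_div_assoc]
    gcongr
    linarith

theorem mainTheorem1 (ε : ℝ) (hε₀ : 0 < ε) (hε₁ : ε < 1 / 10)
    (δ : ℕ → ℝ) (hδ : IsPolyInv δ)
    (γ : ℝ) (hγ₀ : 0 < γ) (hγ₁ : γ < 1 / 2) :
    ∃ M : ℕ, ∀ (Y : Type*) [Fintype Y] (W : BMSChannel Y) (m : ℕ), M < m →
      1 - (m : ℝ) ^ (γ - 1 / 2) ≤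
        (({A : Finset (Fin m) | 1 - ε < rmH W A} ∪
          {A : Finset (Fin m) | rmZ W A < δ (2 ^ m)}).ncard : ℝ) / 2 ^ m := by
  obtain ⟨c, hc, d, hδ⟩ := hδ
  have hl : 0 < Real.log 2 := Real.log_pos one_lt_two
  -- The gap that `rmZ_le_rmH` gives when the entropy is at most `1 - ε`.
  set η := Real.log 2 / 2 * ε with hη
  have hη0 : 0 < η := by positivity
  -- Chosen so that `-log (c / n ^ d) ≤ η * C * m` for `n = 2 ^ m`; the added `1` ensures `1 ≤ C`.
  set C := (|Real.log c| + d * Real.log 2) / η + 1 with hC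
  have hC1 : 1 ≤ C := by
    rw [hC, le_add_iff_nonneg_left]
    positivity
  have hpow := (tendsto_pow_atTop_atTop_of_one_lt (α := ℕ) one_lt_two).eventually hδ
  obtain ⟨M, hM⟩ := Filter.eventually_atTop.1
    ((hpow.and (eventually_log_floor_le C hC1 γ hγ₀)).and (Filter.eventually_gt_atTop 0))
  refine ⟨M, fun Y _ W m hm => ?_⟩
  obtain ⟨⟨hδm, hK⟩, hm0⟩ := hM m hm.le
  have hm1 : (1 : ℝ) ≤ m := by exact_mod_cast hm0
  classical
  set G := {A : Finset (Fin m) | 1 - ε < rmH W A} ∪ {A : Finset (Fin m) | rmZ W A < δ (2 ^ m)}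
  have hD : 0 < c / ((2 ^ m : ℕ) : ℝ) ^ d := by positivity
  have hlogD : -Real.log (c / ((2 ^ m : ℕ) : ℝ) ^ d) ≤ η * (C * m) := by
    rw [Real.log_div hc.ne' (by positivity), Real.log_pow]
    push_cast
    rw [Real.log_pow, hC]
    have e : η * (((|Real.log c| + d * Real.log 2) / η + 1) * m) =
        |Real.log c| * m + d * (m * Real.log 2) + η * m := by
      field_simp
    rw [e]
    nlinarith [neg_abs_le (Real.log c), abs_nonneg (Real.log c)]
  have hcard := card_unpolarized_le W hη0 hD hlogD (Gᶜ).toFinset fun A hA => by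
    simp only [G, Set.mem_toFinset, Set.mem_compl_iff, Set.mem_union, Set.mem_ofPred_eq, not_or,
      not_lt] at hA
    refine ⟨(rmZ_le_rmH W A).trans ?_, hδm.trans hA.2⟩
    have := mul_le_mul_of_nonneg_left (show ε ≤ 1 - rmH W A by linarith [hA.1]) (half_pos hl).le
    linarith
  rw [← Set.ncard_eq_toFinset_card'] at hcard
  have htot : G.ncard + (Gᶜ).ncard = 2 ^ m := by
    rw [Set.ncard_add_ncard_compl]
    simp
  have hbad : ((Gᶜ).ncard : ℝ) ≤ 2 ^ m * (m : ℝ) ^ (γ - 1 / 2) := by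
    calc ((Gᶜ).ncard : ℝ) ≤ (m.choose (m / 2) : ℝ) * ((Nat.log 2 ⌊C * m⌋₊ + 1 : ℕ) : ℝ) := by
          exact_mod_cast hcard
      _ ≤ 2 ^ m * (m : ℝ) ^ (-(1 / 2) : ℝ) * (m : ℝ) ^ γ :=
          mul_le_mul (choose_half_le m hm0) hK (by positivity) (by positivity)
      _ = 2 ^ m * (m : ℝ) ^ (γ - 1 / 2) := by
          rw [mul_assoc, ← Real.rpow_add (by linarith)]
          ring_nf
  have htot' : (G.ncard : ℝ) + ((Gᶜ).ncard : ℝ) = 2 ^ m := by exact_mod_cast htot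
  rw [le_div_iff₀ (by positivity)]
  linarith
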